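/- Let $k\ge 2$ be an integer. For $n\ge 1$ let $T_n$ be the complete $k$-ary tree of height $n$ with root $r$ (every internal vertex, including the root, has exactly $k$ children, and all leaves have height $n$); the trees are nested, $T_n\subset T_{n+1}$, with common root $r$. Let $P_n$ be the transition matrix of the simple random walk on $T_n$, which moves from a vertex to a uniformly chosen neighbour. Let $\mathfrak d\colon\{1,2,\dots\}\to\{0,1,2,\dots\}$ satisfy $\mathfrak d(n)>0$ for infinitely many $n$, and put $S_0=0$, $S_n=\sum_{i=1}^n\mathfrak d(i)$. Let $(X_t)_{t\ge 0}$ be the Markov chain with $X_0=r$ whose step from time $t$ to time $t+1$ is made according to $P_n$ whenever $S_{n-1}\le t<S_n$ (the simple random walk on the growing $k$-ary tree with durations $\mathfrak d$). Let $R(t)=\Pr[X_t=r]$. The root $r$ is called recurrent if $\sum_{t=1}^\infty R(t)=\infty$, and transient if $\sum_{t=0}^\infty R(t)<\infty$. (i) If $\mathfrak d(n)=\Omega\!\left(\dfrac{k^n}{n\log n}\right)$ as $n\to\infty$, then $r$ is recurrent. (ii) If $\mathfrak d(n)=O\!\left(\dfrac{k^n}{n(\log n)^{1+\varepsilon}}\right)$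 as $n\to\infty$ for some constant $\varepsilon>0$, then $r$ is transient. -/

import Mathlib

open Filter Asymptotics
open scoped ENNReal

noncomputable section

/-- The end `T n = 𝔡 1 + ⋯ + 𝔡 n` of the `n`-th phase, with `T 0 = 0`.  The phases are numbered
`1, 2, …`; the value `𝔡 0` is never used. -/
def phaseEnd (d : ℕ → ℕ) (n : ℕ) : ℕ := ∑ i ∈ Finset.Icc 1 n, d i

/-- A random walk on a growing graph `(𝔡, G, P)`, with all vertices taken from a type `α`.  In phase
`n ≥ 1`, that is, for `𝔡 n` steps, the walk moves on the finite simple graph `G n = (V n, E n)` by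
the stochastic matrix `P n`.  All data with index `0` are unused. -/
structure GrowingWalk (α : Type*) where
  /-- the duration `𝔡` of the phases (a phase may have duration `0`) -/
  duration : ℕ → ℕ
  /-- the vertex sets -/
  V : ℕ → Finset α
  /-- the edge sets -/
  E : ℕ → SimpleGraph α
  /-- the transition matrices -/
  P : ℕ → Matrix α α ℝ
  edge_mem : ∀ n, 1 ≤ n → ∀ u v, (E n).Adj u v → u ∈ V n ∧ v ∈ V n
  V_mono : ∀ n, 1 ≤ n → V n ⊆ V (n + 1)
  E_mono : ∀ n, 1 ≤ n → E n ≤ E (n + 1)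
  P_nonneg : ∀ n, 1 ≤ n → ∀ u ∈ V n, ∀ v ∈ V n, 0 ≤ P n u v
  P_sum : ∀ n, 1 ≤ n → ∀ u ∈ V n, ∑ v ∈ V n, P n u v = 1
  /-- the walk moves along the edges (or stays where it is) -/
  P_edge : ∀ n, 1 ≤ n → ∀ u ∈ V n, ∀ v ∈ V n, P n u v ≠ 0 → u = v ∨ (E n).Adj u v
  /-- the graphs that occur have infinitely many vertices altogether -/
  infinite : (⋃ n ∈ {n : ℕ | 1 ≤ n ∧ 0 < duration n}, (V n : Set α)).Infinite

namespace GrowingWalk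

variable {α : Type*} (D : GrowingWalk α)

/-- Every time lies in some phase. -/
theorem exists_lt_phaseEnd (t : ℕ) : ∃ n, t < phaseEnd D.duration n := by
  by_contra! h
  refine D.infinite ?_
  have hsub : {n : ℕ | 1 ≤ n ∧ 0 < D.duration n}.Finite := by
    by_contra hinf
    obtain ⟨s, hs, hcard⟩ := Set.Infinite.exists_subset_card_eq hinf (t + 1)
    have h1 : s ⊆ Finset.Icc 1 (s.sup id) := fun x hx =>
      Finset.mem_Icc.2 ⟨(hs hx).1, Finset.le_sup (f := id) hx⟩
    have h2 : s.card ≤ phaseEnd D.duration (s.sup id) := by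
      calc s.card = ∑ _i ∈ s, 1 := by simp
        _ ≤ ∑ i ∈ s, D.duration i := Finset.sum_le_sum fun i hi => (hs hi).2
        _ ≤ _ := Finset.sum_le_sum_of_subset h1
    have := h (s.sup id)
    omega
  exact hsub.biUnion fun n _ => (D.V n).finite_toSet

/-- The phase of time `t`, that is, the `n` with `T (n - 1) ≤ t < T n`: the step from time `t` to
time `t + 1` is made by `P (phase t)`. -/
def phase (t : ℕ) : ℕ := Nat.find (D.exists_lt_phaseEnd t)

open Classical in
/-- The law of the position `X t` of the walk with `X 0 = v`: `law v t x = Pr[X t = x]`. -/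
def law (v : α) : ℕ → α → ℝ
  | 0 => fun x => if x = v then 1 else 0
  | t + 1 => fun y =>
      if y ∈ D.V (D.phase t) then
        ∑ x ∈ D.V (D.phase t), law v t x * D.P (D.phase t) x y
      else 0

/-- The return probability `R t = Pr[X t = v]` of the walk with `X 0 = v`. -/
def returnProb (v : α) (t : ℕ) : ℝ := D.law v t v

/-- `v` is recurrent: the return probabilities at the times `t ≥ 1` have an infinite sum. -/
def Recurrent (v : α) : Prop := ∑' t : ℕ, ENNReal.ofReal (D.returnProb v (t + 1)) = ∞

/-- `v` is transient: the return probabilities have a finite sum. -/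
def Transient (v : α) : Prop := ∑' t : ℕ, ENNReal.ofReal (D.returnProb v t) < ∞

end GrowingWalk

/-! The complete `k`-ary tree.  A vertex of height `h` is a list of length `h` over `Fin k`; the root
is `[]`, and the children of `u` are the `k` lists `i :: u`. -/

/-- `v` is a child of `u`. -/
abbrev IsChild {k : ℕ} (u v : List (Fin k)) : Prop := ∃ i : Fin k, v = i :: u

/-- The vertices of the complete `k`-ary tree of height `n`. -/
def karyV (k n : ℕ) : Finset (List (Fin k)) := (List.finite_length_le (Fin k) n).toFinset

theorem mem_karyV {k n : ℕ} {u : List (Fin k)} : u ∈ karyV k n ↔ u.length ≤ n := by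
  simp [karyV]

/-- The edges of the complete `k`-ary tree of height `n`: each vertex is joined to its children. -/
def karyE (k n : ℕ) : SimpleGraph (List (Fin k)) where
  Adj u v := u.length ≤ n ∧ v.length ≤ n ∧ (IsChild u v ∨ IsChild v u)
  symm := ⟨fun _ _ h => ⟨h.2.1, h.1, h.2.2.symm⟩⟩
  loopless := ⟨by
    rintro u ⟨-, -, ⟨i, hi⟩ | ⟨i, hi⟩⟩ <;> simpa using congrArg List.length hi⟩

/-- The transition matrix, with parameter `lam`, on the complete `k`-ary tree of height `n`.  (For
`lam = 1` it is the simple random walk on that tree.) -/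
def karyP (k : ℕ) (lam : ℝ) (n : ℕ) : Matrix (List (Fin k)) (List (Fin k)) ℝ := fun u v =>
  if u.length ≤ n ∧ v.length ≤ n then
    if IsChild u v then
      if u = [] then 1 / (k : ℝ) else 1 / (lam + k)
    else if IsChild v u then
      if u.length = n then 1 else lam / (lam + k)
    else 0
  else 0

theorem karyP_sum {k : ℕ} (hk : 2 ≤ k) {lam : ℝ} (hlam : 0 < lam) {n : ℕ} (hn : 1 ≤ n)
    (u : List (Fin k)) (hu : u ∈ karyV k n) : ∑ v ∈ karyV k n, karyP k lam n u v = 1 := by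
  rw [mem_karyV] at hu
  have hk0 : (0 : ℝ) < k := by exact_mod_cast (by omega : 0 < k)
  have hlk : lam + k ≠ 0 := by positivity
  have hup : ∀ c : ℝ, u.length < n →
      ∑ v ∈ karyV k n, (∑ i : Fin k, if v = i :: u then c else 0) = k * c := by
    intro c hlt
    rw [Finset.sum_comm]
    have : ∀ i : Fin k, (i :: u) ∈ karyV k n := fun i => by
      rw [mem_karyV]; simp only [List.length_cons]; omega
    simp [this]
  have hind : ∀ (c : ℝ) (v : List (Fin k)),
      (∑ i : Fin k, if v = i :: u then c else 0) = if IsChild u v then c else 0 := by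
    intro c v
    split_ifs with h
    · obtain ⟨j, rfl⟩ := h
      simp
    · refine Finset.sum_eq_zero fun i _ => if_neg fun hi => h ⟨i, hi⟩
  rcases u with _ | ⟨j, w⟩
  · have := hup (1 / (k : ℝ)) (by simp only [List.length_nil]; omega)
    rw [mul_one_div_cancel hk0.ne'] at this
    rw [← this]
    refine Finset.sum_congr rfl fun v hv => ?_
    rw [mem_karyV] at hv
    rw [hind]
    have : ¬ IsChild v ([] : List (Fin k)) := by rintro ⟨i, hi⟩; simp at hi
    simp [karyP, hv, this]
  · have hw : w ∈ karyV k n := by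
      rw [mem_karyV]; simp only [List.length_cons] at hu; omega
    have hpar : ∀ v, IsChild v (j :: w) ↔ v = w := by
      intro v
      constructor
      · rintro ⟨i, hi⟩
        exact ((List.cons.inj hi).2).symm
      · rintro rfl
        exact ⟨j, rfl⟩
    have hnot : ¬ IsChild (j :: w) w := by
      rintro ⟨i, hi⟩
      have := congrArg List.length hi
      simp only [List.length_cons] at this
      omega
    rcases hu.lt_or_eq with hlt | heq
    · have h1 := hup (1 / (lam + k)) hlt
      have h2 : ∑ v ∈ karyV k n, (if v = w then lam / (lam + k) else 0) = lam / (lam + k) := by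
        simp [hw]
      have h3 : (k : ℝ) * (1 / (lam + k)) + lam / (lam + k) = 1 := by
        field_simp
        ring
      rw [← h3, ← h1, ← h2, ← Finset.sum_add_distrib]
      refine Finset.sum_congr rfl fun v hv => ?_
      rw [mem_karyV] at hv
      rw [hind, karyP, if_pos ⟨hu, hv⟩]
      by_cases hc : IsChild (j :: w) v
      · have hvw : v ≠ w := fun h => hnot (h ▸ hc)
        rw [if_pos hc, if_pos hc, if_neg hvw, if_neg (by simp)]
        simp
      · rw [if_neg hc, if_neg hc, if_neg hlt.ne]
        simp [hpar]
    · have h2 : ∑ v ∈ karyV k n, (if v = w then (1 : ℝ) else 0) = 1 := by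
        simp [hw]
      rw [← h2]
      refine Finset.sum_congr rfl fun v hv => ?_
      rw [mem_karyV] at hv
      rw [karyP, if_pos ⟨hu, hv⟩]
      have hc : ¬ IsChild (j :: w) v := by
        rintro ⟨i, rfl⟩
        simp only [List.length_cons] at hv heq
        omega
      rw [if_neg hc, if_pos heq]
      simp only [hpar]

/-- The random walk with parameter `lam` on the growing complete `k`-ary tree: in phase `n` the graph
is the complete `k`-ary tree of height `n`.  Infinitely many durations have to be positive, so that
the walk has infinitely many steps (and the tree grows infinitely). -/
def karyWalk (k : ℕ) (hk : 2 ≤ k) (lam : ℝ) (hlam : 0 < lam) (d : ℕ → ℕ)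
    (hd : ∃ᶠ n in atTop, 0 < d n) : GrowingWalk (List (Fin k)) where
  duration := d
  V := karyV k
  E := karyE k
  P := karyP k lam
  edge_mem n _ u v h := ⟨mem_karyV.2 h.1, mem_karyV.2 h.2.1⟩
  V_mono n _ u hu := mem_karyV.2 ((mem_karyV.1 hu).trans n.le_succ)
  E_mono n _ := fun _ _ h => ⟨h.1.trans n.le_succ, h.2.1.trans n.le_succ, h.2.2⟩
  P_nonneg n _ u _ v _ := by
    unfold karyP
    split_ifs <;> positivity
  P_sum n hn u hu := karyP_sum hk hlam hn u hu
  P_edge n _ u _ v _ h := by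
    right
    unfold karyP at h
    split_ifs at h with h1 h2 h3 h4 <;> first
      | exact ⟨h1.1, h1.2, Or.inl h2⟩
      | exact ⟨h1.1, h1.2, Or.inr ‹_›⟩
      | exact absurd rfl h
  infinite := by
    have : Nonempty (Fin k) := ⟨⟨0, by omega⟩⟩
    convert Set.infinite_univ (α := List (Fin k))
    refine Set.eq_univ_of_forall fun u => ?_
    obtain ⟨n, hn, hpos⟩ := (frequently_atTop.1 hd) (u.length + 1)
    simp only [Set.mem_iUnion]
    exact ⟨n, ⟨by omega, hpos⟩, Finset.mem_coe.2 (mem_karyV.2 (by omega))⟩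

end

/-! The height of the walk is itself a Markov chain, biased upwards, with reflection at the root and
at the leaves, and two test functions of the height decide the matter.

The function `k⁻ʰ` is harmonic except at the two ends: a step from the root lowers it by `1 - 1/k`,
a step from a leaf of the tree of height `n` raises it by `(k - 1) k⁻ⁿ`. As its expectation stays in
`[0, 1]`, the expected number of returns is, up to constants, the expected number of visits to
leaves, each weighted by `k⁻ⁿ` (`sum_returnProb`).

The function `h` has drift at least `(k - 1)/(k + 1)` off the leaves and `-1` on them. It lies in
`[0, n]` when phase `n` ends, so the leaf time in phase `n` is at least a constant multiple of `d n`
minus `O(n)` (`le_sum_Ico_leafProb`); it is trivially at most `d n`. Since `∑ n / kⁿ` converges, the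
root is recurrent exactly when `∑ d n / kⁿ` diverges, and the logarithmic series gives both
thresholds. -/

noncomputable section

/-! ### Projection of the walk to its height -/

/-- One step of the height of the simple random walk on the `k`-ary tree of height `n`, acting on
functions of the height. -/
def heightStep (k n : ℕ) (f : ℕ → ℝ) (h : ℕ) : ℝ :=
  if h = 0 then f 1 else if h = n then f (h - 1) else (k * f (h + 1) + f (h - 1)) / (1 + k)

/-- The chain can be lumped: the probabilities of moving up and down depend on a vertex only through
its height. -/
theorem sum_karyP_mul {k : ℕ} (hk : 0 < k) {n : ℕ} (hn : 1 ≤ n) (f : ℕ → ℝ)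
    {u : List (Fin k)} (hu : u.length ≤ n) :
    ∑ v ∈ karyV k n, karyP k 1 n u v * f v.length = heightStep k n f u.length := by
  have hk0 : (0 : ℝ) < k := by exact_mod_cast hk
  have hlk : (1 : ℝ) + k ≠ 0 := by positivity
  have hup : ∀ c : ℝ, u.length < n →
      ∑ v ∈ karyV k n, (∑ i : Fin k, if v = i :: u then c else 0) = k * c := by
    intro c hlt
    rw [Finset.sum_comm]
    have : ∀ i : Fin k, (i :: u) ∈ karyV k n := fun i => by
      rw [mem_karyV]; simp only [List.length_cons]; omega
    simp [this]
  have hind : ∀ (c : ℝ) (v : List (Fin k)),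
      (∑ i : Fin k, if v = i :: u then c else 0) = if IsChild u v then c else 0 := by
    intro c v
    split_ifs with h
    · obtain ⟨j, rfl⟩ := h
      simp
    · exact Finset.sum_eq_zero fun i _ => if_neg fun hi => h ⟨i, hi⟩
  rcases u with _ | ⟨j, w⟩
  · have h1 := hup (1 / k * f 1) (by simp only [List.length_nil]; omega)
    have h2 : (k : ℝ) * (1 / k * f 1) = heightStep k n f ([] : List (Fin k)).length := by
      simp only [heightStep, List.length_nil, if_true]
      field_simp
    rw [← h2, ← h1]
    refine Finset.sum_congr rfl fun v hv => ?_
    rw [mem_karyV] at hv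
    rw [hind]
    have : ¬ IsChild v ([] : List (Fin k)) := by rintro ⟨i, hi⟩; simp at hi
    by_cases hc : IsChild [] v
    · rw [if_pos hc, karyP, if_pos ⟨hu, hv⟩, if_pos hc, if_pos rfl]
      obtain ⟨i, rfl⟩ := hc
      rfl
    · simp [karyP, this, hc]
  · have hw : w ∈ karyV k n := by
      rw [mem_karyV]; simp only [List.length_cons] at hu; omega
    have hpar : ∀ v, IsChild v (j :: w) ↔ v = w := by
      intro v
      constructor
      · rintro ⟨i, hi⟩
        exact ((List.cons.inj hi).2).symm
      · rintro rfl
        exact ⟨j, rfl⟩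
    have hnot : ¬ IsChild (j :: w) w := by
      rintro ⟨i, hi⟩
      have := congrArg List.length hi
      simp only [List.length_cons] at this
      omega
    rcases hu.lt_or_eq with hlt | heq
    · have h1 := hup (1 / (1 + k) * f (w.length + 2)) hlt
      have h2 : ∑ v ∈ karyV k n, (if v = w then 1 / (1 + (k : ℝ)) * f w.length else 0)
          = 1 / (1 + k) * f w.length := by
        simp [hw]
      have h3 : (k : ℝ) * (1 / (1 + k) * f (w.length + 2)) + 1 / (1 + k) * f w.length
          = heightStep k n f (j :: w).length := by
        rw [heightStep, if_neg (by simp), if_neg hlt.ne]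
        simp only [List.length_cons, Nat.add_sub_cancel]
        field_simp
      rw [← h3, ← h1, ← h2, ← Finset.sum_add_distrib]
      refine Finset.sum_congr rfl fun v hv => ?_
      rw [mem_karyV] at hv
      rw [hind, karyP, if_pos ⟨hu, hv⟩]
      by_cases hc : IsChild (j :: w) v
      · have hvw : v ≠ w := fun h => hnot (h ▸ hc)
        rw [if_pos hc, if_pos hc, if_neg hvw, if_neg (by simp)]
        obtain ⟨i, rfl⟩ := hc
        simp
      · rw [if_neg hc, if_neg hc, if_neg hlt.ne]
        by_cases hvw : v = w
        · simp [hvw]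
        · simp [hpar, hvw]
    · have h2 : ∑ v ∈ karyV k n, (if v = w then f w.length else 0)
          = heightStep k n f (j :: w).length := by
        rw [heightStep, if_neg (by simp), if_pos heq]
        simp [hw]
      rw [← h2]
      refine Finset.sum_congr rfl fun v hv => ?_
      rw [mem_karyV] at hv
      rw [karyP, if_pos ⟨hu, hv⟩]
      have hc : ¬ IsChild (j :: w) v := by
        rintro ⟨i, rfl⟩
        simp only [List.length_cons] at hv heq
        omega
      rw [if_neg hc, if_pos heq]
      by_cases hvw : v = w
      · simp [hvw]
      · simp [hpar, hvw]

/-! ### Expectations along a growing walk -/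

namespace GrowingWalk

variable {α : Type*} (D : GrowingWalk α)

theorem one_le_phase (t : ℕ) : 1 ≤ D.phase t := by
  have h : t < phaseEnd D.duration (D.phase t) := Nat.find_spec (D.exists_lt_phaseEnd t)
  by_contra! h0
  have : D.phase t = 0 := by omega
  simp [this, phaseEnd] at h

theorem phase_mono : Monotone D.phase := fun _ t h =>
  Nat.find_min' _ (h.trans_lt (Nat.find_spec (D.exists_lt_phaseEnd t)))

theorem phaseEnd_mono (d : ℕ → ℕ) : Monotone (phaseEnd d) := fun _ _ h =>
  Finset.sum_le_sum_of_subset (Finset.Icc_subset_Icc_right h)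

theorem phaseEnd_succ (d : ℕ → ℕ) (n : ℕ) : phaseEnd d (n + 1) = phaseEnd d n + d (n + 1) :=
  Finset.sum_Icc_succ_top (by omega) _

theorem phase_eq {n t : ℕ} (h1 : phaseEnd D.duration n ≤ t)
    (h2 : t < phaseEnd D.duration (n + 1)) : D.phase t = n + 1 :=
  (Nat.find_eq_iff _).2 ⟨h2, fun _ hm =>
    not_lt.2 ((phaseEnd_mono _ (Nat.lt_succ_iff.1 hm)).trans h1)⟩

theorem law_nonneg (v : α) (t : ℕ) (x : α) : 0 ≤ D.law v t x := by
  induction t generalizing x with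
  | zero => unfold law; split_ifs <;> norm_num
  | succ t ih =>
    unfold law
    split_ifs with hx
    · exact Finset.sum_nonneg fun u hu => mul_nonneg (ih u)
        (D.P_nonneg _ (D.one_le_phase t) u hu x hx)
    · exact le_rfl

theorem V_subset {m n : ℕ} (hm : 1 ≤ m) (h : m ≤ n) : D.V m ⊆ D.V n := by
  induction n, h using Nat.le_induction with
  | base => exact subset_rfl
  | succ n hn ih => exact ih.trans (D.V_mono n (hm.trans hn))

/-- The expectation of `f (X t)` for the walk with `X 0 = v`. -/
def expect (v : α) (t : ℕ) (f : α → ℝ) : ℝ := ∑ x ∈ D.V (D.phase t), D.law v t x * f x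

theorem expect_succ (v : α) (t : ℕ) (f : α → ℝ) :
    D.expect v (t + 1) f =
      D.expect v t fun x => ∑ y ∈ D.V (D.phase t), D.P (D.phase t) x y * f y := by
  have hsub : D.V (D.phase t) ⊆ D.V (D.phase (t + 1)) :=
    D.V_subset (D.one_le_phase t) (D.phase_mono t.le_succ)
  unfold expect
  -- The next phase may live on a larger graph, but the law after the step vanishes on the new
  -- vertices.
  rw [← Finset.sum_subset hsub fun y _ hy => by simp [law, hy]]
  calc ∑ y ∈ D.V (D.phase t), D.law v (t + 1) y * f y
      = ∑ y ∈ D.V (D.phase t), ∑ x ∈ D.V (D.phase t),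
          D.law v t x * (D.P (D.phase t) x y * f y) :=
        Finset.sum_congr rfl fun y hy => by
          simp only [law, if_pos hy, Finset.sum_mul, mul_assoc]
    _ = _ := by
        rw [Finset.sum_comm]
        simp only [Finset.mul_sum]

theorem expect_mono (v : α) (t : ℕ) {f g : α → ℝ} (h : ∀ x ∈ D.V (D.phase t), f x ≤ g x) :
    D.expect v t f ≤ D.expect v t g :=
  Finset.sum_le_sum fun x hx => mul_le_mul_of_nonneg_left (h x hx) (D.law_nonneg v t x)

theorem expect_add (v : α) (t : ℕ) (f g : α → ℝ) :
    D.expect v t (fun x => f x + g x) = D.expect v t f + D.expect v t g := by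
  simp [expect, mul_add, Finset.sum_add_distrib]

theorem expect_const_mul (v : α) (t : ℕ) (c : ℝ) (f : α → ℝ) :
    D.expect v t (fun x => c * f x) = c * D.expect v t f := by
  simp [expect, Finset.mul_sum, mul_left_comm]

theorem expect_congr (v : α) (t : ℕ) {f g : α → ℝ} (h : ∀ x ∈ D.V (D.phase t), f x = g x) :
    D.expect v t f = D.expect v t g :=
  Finset.sum_congr rfl fun x hx => by rw [h x hx]

theorem expect_nonneg (v : α) (t : ℕ) {f : α → ℝ} (h : ∀ x, 0 ≤ f x) :
    0 ≤ D.expect v t f :=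
  Finset.sum_nonneg fun x _ => mul_nonneg (D.law_nonneg v t x) (h x)

theorem expect_zero {v : α} (hv : v ∈ D.V (D.phase 0)) (f : α → ℝ) :
    D.expect v 0 f = f v := by
  rw [expect, Finset.sum_eq_single v (fun x _ hx => by simp [law, hx]) (absurd hv)]
  simp [law]

theorem expect_one {v : α} (hv : v ∈ D.V (D.phase 0)) (t : ℕ) :
    D.expect v t (fun _ => 1) = 1 := by
  induction t with
  | zero => exact D.expect_zero hv _
  | succ t ih =>
    rw [expect_succ]
    refine Eq.trans ?_ ih
    exact D.expect_congr v t fun x hx => by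
      simpa using D.P_sum _ (D.one_le_phase t) x hx

/-- A sum over the times before the end of phase `N`, phase by phase. -/
theorem sum_range_phaseEnd (d : ℕ → ℕ) (F : ℕ → ℝ) (N : ℕ) :
    ∑ t ∈ Finset.range (phaseEnd d N), F t =
      ∑ n ∈ Finset.range N, ∑ t ∈ Finset.Ico (phaseEnd d n) (phaseEnd d (n + 1)), F t := by
  induction N with
  | zero => simp [phaseEnd]
  | succ N ih =>
    rw [Finset.sum_range_succ, ← ih, Finset.sum_range_add_sum_Ico _ (phaseEnd_mono d N.le_succ)]

end GrowingWalk

/-! ### Returns to the root against visits to the leaves -/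

section KaryWalk

open GrowingWalk

variable {k : ℕ} (hk : 2 ≤ k) {d : ℕ → ℕ} (hd : ∃ᶠ n in atTop, 0 < d n)

local notation "W" => karyWalk k hk 1 one_pos d hd

theorem nil_mem_karyWalk_V (n : ℕ) : [] ∈ (W).V n := mem_karyV.2 (Nat.zero_le n)

theorem karyWalk_expect_succ (t : ℕ) (f : ℕ → ℝ) :
    (W).expect [] (t + 1) (fun x => f x.length) =
      (W).expect [] t (fun x => heightStep k ((W).phase t) f x.length) := by
  rw [expect_succ]
  exact expect_congr _ _ _ fun x hx =>
    sum_karyP_mul (by omega) ((W).one_le_phase t) f (mem_karyV.1 hx)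

theorem karyWalk_returnProb_eq (t : ℕ) :
    (W).returnProb [] t = (W).expect [] t (fun x => if x.length = 0 then 1 else 0) := by
  unfold expect
  rw [Finset.sum_eq_single []]
  · simp [returnProb]
  · intro x _ hx
    simp [hx]
  · exact fun h => absurd (nil_mem_karyWalk_V hk hd _) h

/-- The probability that the walk is at a leaf at time `t`. -/
def leafProb (t : ℕ) : ℝ :=
  (W).expect [] t (fun x => if x.length = (W).phase t then 1 else 0)

theorem leafProb_le_one (t : ℕ) : leafProb hk hd t ≤ 1 := by
  rw [← (W).expect_one (nil_mem_karyWalk_V hk hd _) t]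
  exact expect_mono _ _ _ fun x _ => by split_ifs <;> norm_num

theorem heightStep_inv_pow {n h : ℕ} (hk0 : 0 < k) (hn : 1 ≤ n) :
    heightStep k n (fun h => ((k : ℝ) ^ h)⁻¹) h = ((k : ℝ) ^ h)⁻¹ +
      (-(1 - (k : ℝ)⁻¹) * (if h = 0 then 1 else 0) +
        (k - 1) * ((k : ℝ) ^ n)⁻¹ * (if h = n then 1 else 0)) := by
  have hk0' : (k : ℝ) ≠ 0 := by exact_mod_cast hk0.ne'
  have hk1 : (1 : ℝ) + k ≠ 0 := by positivity
  unfold heightStep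
  rcases h with _ | h
  · rw [if_pos rfl, if_pos rfl, if_neg (by omega)]
    simp
  · simp only [if_neg (Nat.succ_ne_zero h)]
    by_cases hh : h + 1 = n
    · subst hh
      simp only [if_true, Nat.add_sub_cancel]
      field_simp
      ring
    · simp only [if_neg hh, Nat.add_sub_cancel]
      field_simp
      ring

theorem expect_inv_pow_succ (t : ℕ) :
    (W).expect [] (t + 1) (fun x => ((k : ℝ) ^ x.length)⁻¹) =
      (W).expect [] t (fun x => ((k : ℝ) ^ x.length)⁻¹) +
        (-(1 - (k : ℝ)⁻¹) * (W).returnProb [] t +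
          (k - 1) * ((k : ℝ) ^ (W).phase t)⁻¹ * leafProb hk hd t) := by
  rw [karyWalk_expect_succ hk hd t (fun h => ((k : ℝ) ^ h)⁻¹), karyWalk_returnProb_eq, leafProb,
    ← expect_const_mul, ← expect_const_mul, ← expect_add, ← expect_add]
  exact expect_congr _ _ _ fun x _ => heightStep_inv_pow (by omega) ((W).one_le_phase t)

/-- The one-step identity telescopes, starting from the value `1` at the root. -/
theorem sum_returnProb (T : ℕ) :
    (1 - (k : ℝ)⁻¹) * ∑ t ∈ Finset.range T, (W).returnProb [] t =
      1 - (W).expect [] T (fun x => ((k : ℝ) ^ x.length)⁻¹) +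
        (k - 1) * ∑ t ∈ Finset.range T, ((k : ℝ) ^ (W).phase t)⁻¹ * leafProb hk hd t := by
  induction T with
  | zero => simp [expect_zero _ (nil_mem_karyWalk_V hk hd _)]
  | succ T ih =>
    rw [Finset.sum_range_succ, Finset.sum_range_succ, mul_add, ih, expect_inv_pow_succ]
    ring

theorem sum_Ico_leafProb (n : ℕ) :
    ∑ t ∈ Finset.Ico (phaseEnd d n) (phaseEnd d (n + 1)),
        ((k : ℝ) ^ (W).phase t)⁻¹ * leafProb hk hd t =
      ((k : ℝ) ^ (n + 1))⁻¹ *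
        ∑ t ∈ Finset.Ico (phaseEnd d n) (phaseEnd d (n + 1)), leafProb hk hd t := by
  rw [Finset.mul_sum]
  refine Finset.sum_congr rfl fun t ht => ?_
  rw [Finset.mem_Ico] at ht
  rw [(W).phase_eq ht.1 ht.2]

theorem sum_Ico_leafProb_le (n : ℕ) :
    ∑ t ∈ Finset.Ico (phaseEnd d n) (phaseEnd d (n + 1)), leafProb hk hd t ≤ d (n + 1) := by
  refine (Finset.sum_le_sum fun t _ => leafProb_le_one hk hd t).trans ?_
  simp [phaseEnd_succ]

/-! ### Leaf time from the drift of the height -/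

/-- At a leaf the step is `-1 = (k - 1)/(k + 1) - 2k/(k + 1)`. Only the root, where the step is
`+1`, makes this an inequality. -/
theorem expect_length_succ (t : ℕ) :
    (W).expect [] t (fun x => (x.length : ℝ)) +
        ((k - 1) / (k + 1) - 2 * k / (k + 1) * leafProb hk hd t) ≤
      (W).expect [] (t + 1) (fun x => (x.length : ℝ)) := by
  have hk0 : (0 : ℝ) < k := by exact_mod_cast (by omega : 0 < k)
  have h1 := (W).expect_one (nil_mem_karyWalk_V hk hd _) t
  calc _ = (W).expect [] t (fun x => (x.length : ℝ) + ((k - 1) / (k + 1) * 1 +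
          -(2 * k / (k + 1)) * (if x.length = (W).phase t then 1 else 0))) := by
        rw [expect_add, expect_add, expect_const_mul, expect_const_mul, h1, leafProb]
        ring
    _ ≤ _ := by
        rw [karyWalk_expect_succ hk hd t (fun h => (h : ℝ))]
        refine expect_mono _ _ _ fun x _ => ?_
        have hn := (W).one_le_phase t
        generalize (W).phase t = n at hn
        generalize x.length = h
        unfold heightStep
        rcases h with _ | h
        · rw [if_pos rfl, if_neg (by omega)]
          have : ((k : ℝ) - 1) / (k + 1) ≤ 1 := by
            rw [div_le_one (by positivity)]; linarith
          push_cast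
          linarith
        · simp only [if_neg (Nat.succ_ne_zero h)]
          apply le_of_eq
          by_cases hh : h + 1 = n
          · simp only [if_pos hh, Nat.add_sub_cancel]
            push_cast
            field_simp
            ring
          · simp only [if_neg hh, Nat.add_sub_cancel]
            push_cast
            field_simp
            ring

theorem heightStep_length_le {n h : ℕ} (hn : 1 ≤ n) (hh : h ≤ n) :
    heightStep k n (fun h => (h : ℝ)) h ≤ n := by
  have hn' : (1 : ℝ) ≤ n := by exact_mod_cast hn
  unfold heightStep
  split_ifs with h0 h1
  · simpa using hn'
  · exact Nat.cast_le.2 (by omega)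
  · rw [div_le_iff₀ (by positivity)]
    have h2 : ((h + 1 : ℕ) : ℝ) ≤ n := by exact_mod_cast (by omega : h + 1 ≤ n)
    have h3 : ((h - 1 : ℕ) : ℝ) ≤ n := by exact_mod_cast (by omega : h - 1 ≤ n)
    have h4 := mul_le_mul_of_nonneg_left h2 (Nat.cast_nonneg (α := ℝ) k)
    linarith

theorem expect_length_phaseEnd_le (n : ℕ) :
    (W).expect [] (phaseEnd d (n + 1)) (fun x => (x.length : ℝ)) ≤ n + 1 := by
  -- The phase at this time is already a later one, so the bound has to come from the last step
  -- made, whose phase is at most `n + 1`. If there is none, the walk is still at the root.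
  rcases hT : phaseEnd d (n + 1) with _ | t
  · rw [expect_zero _ (nil_mem_karyWalk_V hk hd _)]
    simp only [List.length_nil, Nat.cast_zero]
    positivity
  · have hph : (W).phase t ≤ n + 1 := by
      refine Nat.find_min' _ ?_
      change t < phaseEnd d (n + 1)
      omega
    have h1 := (W).expect_one (nil_mem_karyWalk_V hk hd _) t
    calc _ = (W).expect [] t
          (fun x => heightStep k ((W).phase t) (fun h => (h : ℝ)) x.length) :=
          karyWalk_expect_succ hk hd t (fun h => (h : ℝ))
      _ ≤ (W).expect [] t (fun _ => (n + 1 : ℝ) * 1) := by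
          refine expect_mono _ _ _ fun x hx => ?_
          refine (heightStep_length_le ((W).one_le_phase t) (mem_karyV.1 hx)).trans ?_
          rw [mul_one]
          exact_mod_cast hph
      _ = n + 1 := by rw [expect_const_mul, h1, mul_one]

/-- The total drift over a phase is at most the gain in expected height, hence at most `n + 1`; too
little time at the leaves would violate this. -/
theorem le_sum_Ico_leafProb (n : ℕ) :
    ((k : ℝ) - 1) * d (n + 1) - (k + 1) * (n + 1) ≤
      2 * k * ∑ t ∈ Finset.Ico (phaseEnd d n) (phaseEnd d (n + 1)), leafProb hk hd t := by
  have hk1 : (0 : ℝ) < k + 1 := by positivity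
  have hle := phaseEnd_mono d n.le_succ
  set L : ℕ → ℝ := fun t => (W).expect [] t (fun x => (x.length : ℝ)) with hL
  have hsum : ∑ t ∈ Finset.Ico (phaseEnd d n) (phaseEnd d (n + 1)),
      (((k : ℝ) - 1) / (k + 1) - 2 * k / (k + 1) * leafProb hk hd t) ≤ n + 1 :=
    calc _ ≤ ∑ t ∈ Finset.Ico (phaseEnd d n) (phaseEnd d (n + 1)), (L (t + 1) - L t) :=
          Finset.sum_le_sum fun t _ => by
            have := expect_length_succ hk hd t
            simp only [hL]
            linarith
      _ = L (phaseEnd d (n + 1)) - L (phaseEnd d n) := by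
          rw [Finset.sum_Ico_eq_sub _ hle, Finset.sum_range_sub, Finset.sum_range_sub]
          ring
      _ ≤ n + 1 := by
          have h1 := expect_length_phaseEnd_le hk hd n
          have h2 : 0 ≤ L (phaseEnd d n) := expect_nonneg _ _ _ fun x => Nat.cast_nonneg _
          simp only [hL] at h2 ⊢
          linarith
  rw [Finset.sum_sub_distrib, ← Finset.mul_sum, Finset.sum_const, Nat.card_Ico, phaseEnd_succ,
    Nat.add_sub_cancel_left, nsmul_eq_mul, ← phaseEnd_succ, mul_div_assoc', div_mul_eq_mul_div,
    ← sub_div, div_le_iff₀ hk1] at hsum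
  linarith

theorem returnProb_nonneg (t : ℕ) : 0 ≤ (W).returnProb [] t := law_nonneg _ _ _ _

/-! ### Criterion by the series of `d n / k ^ n` -/

/-- The root is transient if the series of `d n / k ^ n` converges. -/
theorem karyWalk_transient (h : Summable fun n : ℕ => (d n : ℝ) / (k : ℝ) ^ n) :
    (W).Transient [] := by
  have hk1 : (1 : ℝ) < k := by exact_mod_cast (by omega : 1 < k)
  have hc : 0 < 1 - (k : ℝ)⁻¹ := sub_pos.2 (inv_lt_one_of_one_lt₀ hk1)
  set S := ∑' n : ℕ, (d n : ℝ) / (k : ℝ) ^ n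
  have hleaf : ∀ t, 0 ≤ leafProb hk hd t := fun t => expect_nonneg _ _ _ fun x => by
    split_ifs <;> norm_num
  have hterm : ∀ n, 0 ≤ (d n : ℝ) / (k : ℝ) ^ n := fun n => by positivity
  have hbound : ∀ T, ∑ t ∈ Finset.range T, ((k : ℝ) ^ (W).phase t)⁻¹ * leafProb hk hd t ≤ S := by
    intro T
    obtain ⟨N, hN⟩ := (W).exists_lt_phaseEnd T
    calc _ ≤ ∑ t ∈ Finset.range (phaseEnd d N),
            ((k : ℝ) ^ (W).phase t)⁻¹ * leafProb hk hd t :=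
          Finset.sum_le_sum_of_subset_of_nonneg (Finset.range_subset_range.2 hN.le)
            fun t _ _ => mul_nonneg (by positivity) (hleaf t)
      _ ≤ ∑ n ∈ Finset.range N, (d (n + 1) : ℝ) / (k : ℝ) ^ (n + 1) := by
          rw [sum_range_phaseEnd]
          refine Finset.sum_le_sum fun n _ => ?_
          rw [sum_Ico_leafProb, div_eq_inv_mul]
          exact mul_le_mul_of_nonneg_left (sum_Ico_leafProb_le hk hd n) (by positivity)
      _ ≤ ∑ n ∈ Finset.range (N + 1), (d n : ℝ) / (k : ℝ) ^ n := by
          rw [Finset.sum_range_succ']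
          exact le_add_of_nonneg_right (hterm 0)
      _ ≤ S := h.sum_le_tsum _ fun n _ => hterm n
  have hs : Summable fun t => (W).returnProb [] t := by
    refine summable_of_sum_range_le (c := (1 + (k - 1) * S) / (1 - (k : ℝ)⁻¹))
      (returnProb_nonneg hk hd) fun T => ?_
    rw [le_div_iff₀' hc, sum_returnProb]
    have h1 : 0 ≤ (W).expect [] T (fun x => ((k : ℝ) ^ x.length)⁻¹) :=
      expect_nonneg _ _ _ fun x => by positivity
    have h2 := mul_le_mul_of_nonneg_left (hbound T) (sub_nonneg.2 hk1.le)
    linarith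
  rw [Transient, ← ENNReal.ofReal_tsum_of_nonneg (returnProb_nonneg hk hd) hs]
  exact ENNReal.ofReal_lt_top

/-- The root is recurrent if the series of `d n / k ^ n` diverges. -/
theorem karyWalk_recurrent (h : ¬ Summable fun n : ℕ => (d n : ℝ) / (k : ℝ) ^ n) :
    (W).Recurrent [] := by
  have hk1 : (1 : ℝ) < k := by exact_mod_cast (by omega : 1 < k)
  have hc : 0 ≤ 1 - (k : ℝ)⁻¹ := sub_nonneg.2 (inv_le_one_of_one_le₀ hk1.le)
  by_contra hfin
  refine h ((summable_nat_add_iff 1).1 ?_)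
  have hs : Summable fun t => (W).returnProb [] t := by
    refine (summable_nat_add_iff 1).1 ?_
    refine (ENNReal.summable_toReal hfin).congr fun t => ?_
    exact ENNReal.toReal_ofReal (returnProb_nonneg hk hd _)
  -- The `O(n)` loss in the leaf time of each phase costs only a convergent series.
  have hgeom : Summable fun n : ℕ => ((n + 1 : ℕ) : ℝ) / (k : ℝ) ^ (n + 1) := by
    refine (summable_nat_add_iff 1 (f := fun n : ℕ => (n : ℝ) / (k : ℝ) ^ n)).2 ?_
    have := summable_pow_mul_geometric_of_norm_lt_one (R := ℝ) 1 (r := (k : ℝ)⁻¹)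
      (by rw [norm_inv, Real.norm_natCast]; exact inv_lt_one_of_one_lt₀ hk1)
    refine this.congr fun n => ?_
    rw [pow_one, inv_pow, div_eq_mul_inv]
  set B := (1 - (k : ℝ)⁻¹) * ∑' t, (W).returnProb [] t
  set G := ∑' n : ℕ, ((n + 1 : ℕ) : ℝ) / (k : ℝ) ^ (n + 1)
  -- The bound is `hsum` times `k - 1`, with `hB` times `2k` and `hG` times `(k - 1)(k + 1)`
  -- inserted.
  refine summable_of_sum_range_le (c := (2 * k * B + (k - 1) * ((k + 1) * G)) / (k - 1) ^ 2)
    (fun n => by positivity) fun N => ?_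
  have hk1' : (0 : ℝ) < k - 1 := sub_pos.2 hk1
  rw [le_div_iff₀' (by positivity)]
  have hle1 : ∀ T, (W).expect [] T (fun x => ((k : ℝ) ^ x.length)⁻¹) ≤ 1 := fun T =>
    (expect_mono _ _ _ fun x _ => inv_le_one_of_one_le₀ (one_le_pow₀ hk1.le)).trans_eq
      ((W).expect_one (nil_mem_karyWalk_V hk hd _) T)
  have hB : (k - 1) * ∑ n ∈ Finset.range N, ((k : ℝ) ^ (n + 1))⁻¹ *
      ∑ t ∈ Finset.Ico (phaseEnd d n) (phaseEnd d (n + 1)), leafProb hk hd t ≤ B := by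
    have h1 := sum_returnProb hk hd (phaseEnd d N)
    rw [sum_range_phaseEnd d (fun t => ((k : ℝ) ^ (W).phase t)⁻¹ * leafProb hk hd t)] at h1
    simp only [sum_Ico_leafProb] at h1
    have h2 := mul_le_mul_of_nonneg_left
      (hs.sum_le_tsum (Finset.range (phaseEnd d N)) fun t _ => returnProb_nonneg hk hd t) hc
    have h3 := hle1 (phaseEnd d N)
    linarith
  have hG : ∑ n ∈ Finset.range N, ((n + 1 : ℕ) : ℝ) / (k : ℝ) ^ (n + 1) ≤ G :=
    hgeom.sum_le_tsum _ fun n _ => by positivity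
  have hsum : (k - 1) * ∑ n ∈ Finset.range N, (d (n + 1) : ℝ) / (k : ℝ) ^ (n + 1) -
      (k + 1) * ∑ n ∈ Finset.range N, ((n + 1 : ℕ) : ℝ) / (k : ℝ) ^ (n + 1) ≤
      2 * k * ∑ n ∈ Finset.range N, ((k : ℝ) ^ (n + 1))⁻¹ *
        ∑ t ∈ Finset.Ico (phaseEnd d n) (phaseEnd d (n + 1)), leafProb hk hd t := by
    rw [Finset.mul_sum, Finset.mul_sum, Finset.mul_sum, ← Finset.sum_sub_distrib]
    refine Finset.sum_le_sum fun n _ => ?_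
    have := mul_le_mul_of_nonneg_left (le_sum_Ico_leafProb hk hd n)
      (by positivity : 0 ≤ ((k : ℝ) ^ (n + 1))⁻¹)
    push_cast
    rw [div_eq_mul_inv, div_eq_mul_inv]
    linarith
  have e1 := mul_le_mul_of_nonneg_left hsum hk1'.le
  have e2 := mul_le_mul_of_nonneg_left hG (by positivity : (0 : ℝ) ≤ (k - 1) * (k + 1))
  have e3 := mul_le_mul_of_nonneg_left hB (by positivity : (0 : ℝ) ≤ 2 * k)
  linarith

end KaryWalk

/-! ### Logarithmic series and the two thresholds -/

/-- The series of `1 / (n * log n ^ p)` converges if and only if `1 < p`. -/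
theorem summable_one_div_nat_mul_log_rpow {p : ℝ} (hp : 0 ≤ p) :
    (Summable fun n : ℕ => 1 / ((n : ℝ) * Real.log n ^ p)) ↔ 1 < p := by
  have hpos : ∀ n : ℕ, 2 ≤ n → 0 < (n : ℝ) * Real.log n ^ p := fun n hn => by
    have : (1 : ℝ) < n := by exact_mod_cast hn
    have := Real.log_pos this
    positivity
  -- Cauchy condensation: at `2ⁿ` the term times `2ⁿ` is `(n log 2)⁻ᵖ`, a `p`-series up to a
  -- constant.
  rw [← summable_condensed_iff_of_eventually_nonneg]
  · have hl : (0 : ℝ) < Real.log 2 ^ p := Real.rpow_pos_of_pos (Real.log_pos one_lt_two) p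
    rw [← Real.summable_one_div_nat_rpow (p := p),
      ← summable_mul_left_iff (inv_ne_zero hl.ne') (f := fun n : ℕ => 1 / (n : ℝ) ^ p)]
    refine summable_congr fun n => ?_
    push_cast
    rw [Real.log_pow, Real.mul_rpow (Nat.cast_nonneg n) (Real.log_pos one_lt_two).le,
      one_div, one_div, mul_inv, mul_inv, mul_inv_cancel_left₀ (by positivity), mul_comm]
  · filter_upwards with n
    have := Real.log_natCast_nonneg n
    positivity
  -- Monotonicity can fail before `2`, where `log 1 = 0` makes a term `1 / 0 = 0`.
  · filter_upwards [eventually_ge_atTop 2] with n hn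
    refine one_div_le_one_div_of_le (hpos n hn) ?_
    have h1 : (n : ℝ) ≤ ((n + 1 : ℕ) : ℝ) := by exact_mod_cast n.le_succ
    have h0 : (0 : ℝ) < n := by exact_mod_cast (by omega : 0 < n)
    have := Real.log_natCast_nonneg n
    gcongr

end

theorem corollary4p3 (k : ℕ) (hk : 2 ≤ k) (d : ℕ → ℕ) (hd : ∃ᶠ n in atTop, 0 < d n) :
    (((fun n : ℕ => (k : ℝ) ^ n / ((n : ℝ) * Real.log n)) =O[atTop] fun n : ℕ => (d n : ℝ)) →
      (karyWalk k hk 1 one_pos d hd).Recurrent []) ∧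
    (∀ ε : ℝ, 0 < ε →
      ((fun n : ℕ => (d n : ℝ)) =O[atTop]
        fun n : ℕ => (k : ℝ) ^ n / ((n : ℝ) * Real.log n ^ (1 + ε))) →
      (karyWalk k hk 1 one_pos d hd).Transient []) := by
  have hk0 : (k : ℝ) ≠ 0 := by exact_mod_cast (by omega : k ≠ 0)
  have hdiv : ∀ x : ℕ → ℝ, ((fun n : ℕ => (k : ℝ) ^ n / x n * (1 / (k : ℝ) ^ n)) =
      fun n => 1 / x n) := fun x => funext fun n => by
    rw [div_mul_div_comm, mul_one, mul_comm (x n), ← div_div, div_self (pow_ne_zero n hk0)]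
  have hd' : (fun n : ℕ => (d n : ℝ) * (1 / (k : ℝ) ^ n)) = fun n => (d n : ℝ) / (k : ℝ) ^ n :=
    funext fun n => mul_one_div _ _
  refine ⟨fun h => karyWalk_recurrent hk hd fun hs => ?_, fun ε hε h =>
    karyWalk_transient hk hd ?_⟩
  · have h1 := h.mul (isBigO_refl (fun n : ℕ => 1 / (k : ℝ) ^ n) atTop)
    rw [hdiv, hd'] at h1
    -- Convergence of `∑ d n / kⁿ` would force that of `∑ 1 / (n log n)`, the excluded case `p = 1`.
    refine lt_irrefl (1 : ℝ) ((summable_one_div_nat_mul_log_rpow zero_le_one).1 ?_)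
    simpa only [Real.rpow_one] using summable_of_isBigO_nat hs h1
  · have h1 := h.mul (isBigO_refl (fun n : ℕ => 1 / (k : ℝ) ^ n) atTop)
    rw [hdiv, hd'] at h1
    exact summable_of_isBigO_nat
      ((summable_one_div_nat_mul_log_rpow (by linarith)).2 (by linarith)) h1
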